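/- **Conventions.** A *map* on the two-sphere is understood combinatorially, as usual: it is a finite connected graph cellularly embedded in the oriented sphere $S^2$, recorded by its finite non-empty set of darts (directed edges), the fixed-point-free involution $\alpha$ reversing darts, and the permutation $\sigma$ rotating each dart counterclockwise to the next dart with the same origin; $\langle\sigma,\alpha\rangle$ acts transitively. Vertices, edges and faces are the cycles of $\sigma$, $\alpha$ and $\varphi=\sigma^{-1}\alpha$ respectively, valences of vertices and numbers of sides of faces are the lengths of the cycles, and the surface being $S^2$ means $V-E+F=2$. (Loops and multiple edges are allowed, as are edges with the same face on both sides.) Let $k,l\ge 3$ and let $n\geq 1$ divide $l$. A *generalised football pattern of type $(k,l,n)$ on $S^2$* (a *spherical realisation* of $(k,l,n)$) is a map on $S^2$ with faces painted black or white and with all vertices of valence at least $3$, such that the black faces are $k$-gons, the white faces are $l$-gons, every edge of a black face has a white face on its other side, and, in the cyclic order of the edges of each white face, exactly every $n$-th edge has a black face on its other side while all its other edges have white faces on their other sides. A realisation is *minimal* if no realisation of the same triple has fewer faces. A *branched cover* $M\to N$ of such patterns, *branched only in the vertices*, is an orientation-preserving branched covering of the underlying surfaces that carries vertices to vertices, edges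 to edges, and faces to faces of the same colour, with all branching located at vertices; combinatorially, it is a surjection $f$ from the darts of $M$ to those of $N$ with $f\sigma=\sigma f$ and $f\alpha=\alpha f$ that preserves the colours and the numbers of sides of the faces. An *isomorphism* is such a map that is bijective on darts. **Theorem.** Let $k,l\geq 3$ with $l$ even, and suppose that $(k,l,2)$ is realised by a generalised football pattern on $S^2$. Then $(k,l,2)$ has a minimal realisation; for every minimal realisation $M_0$ and every spherical realisation $M$ of $(k,l,2)$ there is a branched cover $M\to M_0$, branched only in the vertices; and any two minimal realisations of $(k,l,2)$ are isomorphic. -/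

import Mathlib

universe u

/-- A finite connected map (a graph cellularly embedded in a closed oriented surface), given in the
usual combinatorial way by its darts. A dart is an edge together with a direction; `rev` reverses
the direction, and `rot` sends a dart to the next dart, counterclockwise, with the same origin. -/
structure OrientedMap where
  /-- the oriented edges -/
  Dart : Type u
  finite_dart : Finite Dart
  nonempty_dart : Nonempty Dart
  /-- counterclockwise rotation about the origin of a dart -/
  rot : Equiv.Perm Dart
  /-- reversal of a dart -/
  rev : Equiv.Perm Dart
  rev_rev : ∀ d, rev (rev d) = d
  rev_ne : ∀ d, rev d ≠ d
  connected : ∀ d e : Dart, ∃ g ∈ Subgroup.closure {rot, rev}, g d = e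

namespace OrientedMap

variable (M : OrientedMap.{u})

/-- `M.next d` is the dart that follows `d` on the boundary of the face to the left of `d`:
at the end point of `d`, take the clockwise successor of the reversal of `d`. -/
def next : Equiv.Perm M.Dart := M.rot⁻¹ * M.rev

/-- Vertices are the cycles (fixed points included) of the rotation. -/
def Vertex : Type u := Quotient (Equiv.Perm.SameCycle.setoid M.rot)

/-- Edges are the pairs consisting of a dart and its reversal. -/
def Edge : Type u := Quotient (Equiv.Perm.SameCycle.setoid M.rev)

/-- Faces are the cycles (fixed points included) of `next`. -/
def Face : Type u := Quotient (Equiv.Perm.SameCycle.setoid M.next)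

/-- The face to the left of a dart; the face on the other side of the edge is
`M.face (M.rev d)`. -/
def face (d : M.Dart) : M.Face := Quotient.mk (Equiv.Perm.SameCycle.setoid M.next) d

/-- The valence of the origin of a dart: the length of its cycle under the rotation. -/
noncomputable def valence (d : M.Dart) : ℕ := Function.minimalPeriod M.rot d

/-- The number of sides of the polygon to the left of a dart: the length of its cycle
under `next`. -/
noncomputable def faceDegree (d : M.Dart) : ℕ := Function.minimalPeriod M.next d

/-- The underlying closed connected oriented surface is the two-sphere: its Euler characteristic
is two. -/
def IsSpherical : Prop :=
  (Nat.card M.Vertex : ℤ) - Nat.card M.Edge + Nat.card M.Face = 2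

end OrientedMap

/-- A map with black and white faces; the faces that are not black are white. -/
structure PaintedMap extends OrientedMap.{u} where
  /-- the black faces -/
  black : Set toOrientedMap.Face

namespace PaintedMap

/-- The dart has a black face to its left. -/
def IsBlack (M : PaintedMap.{u}) (d : M.Dart) : Prop := M.face d ∈ M.black

/-- `M` is a generalised football pattern on the two-sphere of type `(k, l, n)`: the black faces
are `k`-gons, the white faces are `l`-gons, edges of black faces meet only edges of white faces,
and exactly every `n`-th edge of each white face meets an edge of a black face. -/
structure IsFootballPattern (M : PaintedMap.{u}) (k l n : ℕ) : Prop where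
  spherical : M.IsSpherical
  three_le_valence : ∀ d, 3 ≤ M.valence d
  faceDegree_black : ∀ d, M.IsBlack d → M.faceDegree d = k
  faceDegree_white : ∀ d, ¬ M.IsBlack d → M.faceDegree d = l
  black_meets : ∀ d, M.IsBlack d → ¬ M.IsBlack (M.rev d)
  white_meets : ∀ d, ¬ M.IsBlack d →
    ∃ i : ℕ, ∀ j : ℕ, M.IsBlack (M.rev ((M.next ^ j) d)) ↔ j ≡ i [MOD n]

/-- A minimal realisation of `(k, l, n)`: one with the smallest possible number of faces. -/
def IsMinimalRealisation (M : PaintedMap.{u}) (k l n : ℕ) : Prop :=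
  M.IsFootballPattern k l n ∧
    ∀ N : PaintedMap.{u}, N.IsFootballPattern k l n → Nat.card M.Face ≤ Nat.card N.Face

/-- A branched cover `M → N`, branched only in the vertices, in terms of darts. It carries vertices
to vertices, edges to edges and faces to faces of the same colour, and respects the orientations.
It is unbranched in the faces since a face and its image have the same number of sides, and
unbranched along the edges since `rev` has no fixed points. At the origin of a dart `d` its local
degree is `M.valence d / N.valence (f d)`, which may be larger than one. -/
structure BranchedCover (M N : PaintedMap.{u}) where
  /-- the action on darts -/
  toFun : M.Dart → N.Dart
  surjective : Function.Surjective toFun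
  map_rot : ∀ d, toFun (M.rot d) = N.rot (toFun d)
  map_rev : ∀ d, toFun (M.rev d) = N.rev (toFun d)
  faceDegree_eq : ∀ d, M.faceDegree d = N.faceDegree (toFun d)
  isBlack_iff : ∀ d, M.IsBlack d ↔ N.IsBlack (toFun d)

/-- An isomorphism of painted maps (preserving orientation and colours). -/
structure Iso (M N : PaintedMap.{u}) where
  /-- the bijection between the darts -/
  toEquiv : M.Dart ≃ N.Dart
  map_rot : ∀ d, toEquiv (M.rot d) = N.rot (toEquiv d)
  map_rev : ∀ d, toEquiv (M.rev d) = N.rev (toEquiv d)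
  isBlack_iff : ∀ d, M.IsBlack d ↔ N.IsBlack (toEquiv d)

end PaintedMap

/-! For n = 2 there is a universal pattern: a trivalent `T` that every realisation covers. Label a
dart 0, 1 or 2 according as black lies on its left, on its right, or on neither side. Rotation adds
1 to the label and reversal is `s ↦ 1 - s` (`isGrading_side`), so all valences are divisible by 3.
Counting darts by label and using V - E + F = 2 gives 1/k + 2/l > 1/2 (`half_lt`), the condition for
the triangle group (2, k, l/2) to be spherical. Finite groups with generators of these exact orders
then yield `T`.

A covering `M → T` comes from a component `P` of the fibre product of `M` and `T` over the labels.
Valences of `T` divide those of `M`, and face degrees agree, so `P → M` is unbranched. Since `M` is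
a sphere and χ(P) ≤ 2 (`eulerChar_le_two`), `P → M` is bijective; its inverse followed by `P → T` is
the required map (`IsSpherical.exists_hom`). Hence `T` has the fewest faces, and a minimal
realisation covers `T` with degree one, so it is isomorphic to `T`. -/

/-! ### Counting cycles of a permutation, and its sign. -/

namespace Equiv.Perm

open Function

variable {D : Type*}

/-- The number of cycles of a permutation, fixed points included. -/
noncomputable def numCycles (σ : Perm D) : ℕ := Nat.card (Quotient (SameCycle.setoid σ))

theorem ncard_sameCycle [Finite D] (σ : Perm D) (x : D) :
    Set.ncard {y | σ.SameCycle x y} = minimalPeriod σ x := by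
  classical
  have := Fintype.ofFinite D
  have h : {y | σ.SameCycle x y} = MulAction.orbit (Subgroup.zpowers σ) x := by
    ext y
    constructor
    · rintro ⟨n, hn⟩
      exact ⟨⟨σ ^ n, n, rfl⟩, hn⟩
    · rintro ⟨⟨_, n, rfl⟩, hn⟩
      exact ⟨n, hn⟩
  rw [h]
  have := MulAction.minimalPeriod_eq_card (a := σ) (b := x)
  rw [← Nat.card_coe_set_eq, Nat.card_eq_fintype_card, ← this]
  rfl

theorem minimalPeriod_pos [Finite D] (σ : Perm D) (x : D) : 0 < minimalPeriod σ x := by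
  rw [← ncard_sameCycle, Set.ncard_pos]
  exact ⟨x, SameCycle.refl σ x⟩

/-- A cycle of length p contributes p terms 1/p. Written this way, numbers of vertices, edges and
faces become sums over darts, which can be split by label or by fibre. -/
theorem numCycles_eq_sum [Fintype D] (σ : Perm D) :
    (numCycles σ : ℚ) = ∑ x, (minimalPeriod σ x : ℚ)⁻¹ := by
  classical
  have := Fintype.ofFinite (Quotient (SameCycle.setoid σ))
  rw [← Finset.sum_fiberwise (g := fun x => (Quotient.mk (SameCycle.setoid σ) x)), numCycles,
    Nat.card_eq_fintype_card, Fintype.card_eq_sum_ones, Nat.cast_sum]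
  refine Finset.sum_congr rfl fun q _ => ?_
  induction q using Quotient.inductionOn with | _ x =>
  have hx : ∀ y ∈ Finset.univ.filter fun y => (Quotient.mk (SameCycle.setoid σ) y) = ⟦x⟧,
      (minimalPeriod σ y : ℚ)⁻¹ = (minimalPeriod σ x : ℚ)⁻¹ := by
    intro y hy
    have hxy : σ.SameCycle y x := Quotient.exact (Finset.mem_filter.1 hy).2
    rw [← ncard_sameCycle, ← ncard_sameCycle]
    congr 3
    ext z
    exact ⟨fun h => hxy.symm.trans h, fun h => hxy.trans h⟩
  rw [Finset.sum_congr rfl hx, Finset.sum_const, nsmul_eq_mul]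
  have hc : (Finset.univ.filter fun y => (Quotient.mk (SameCycle.setoid σ) y) = ⟦x⟧).card
      = minimalPeriod σ x := by
    rw [← ncard_sameCycle, ← Set.ncard_coe_finset]
    congr 1
    ext y
    simp only [Finset.coe_filter, Finset.mem_univ, true_and, Set.mem_ofPred_eq]
    exact ⟨fun h => (Quotient.exact h : σ.SameCycle y x).symm, fun h => Quotient.sound h.symm⟩
  rw [hc, Nat.cast_one, mul_inv_cancel₀]
  exact_mod_cast (minimalPeriod_pos σ x).ne'

/-- `cycleType` omits fixed points while `numCycles` counts them; the identity reconciles the two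
for the sign formula. -/
theorem numCycles_add_card_support [Fintype D] [DecidableEq D] (σ : Perm D) :
    numCycles σ + σ.cycleType.sum = Fintype.card D + σ.cycleType.card := by
  have h1 : ∀ c ∈ σ.cycleFactorsFinset,
      ∑ x ∈ c.support, (minimalPeriod σ x : ℚ)⁻¹ = 1 := by
    intro c hc
    have hx : ∀ x ∈ c.support, (minimalPeriod σ x : ℚ)⁻¹ = (c.support.card : ℚ)⁻¹ := by
      intro x hx
      rw [← ncard_sameCycle, ← Set.ncard_coe_finset]
      congr 3
      ext y
      have hxs := mem_cycleFactorsFinset_support_le hc hx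
      rw [cycle_is_cycleOf hx hc, Finset.mem_coe, mem_support_cycleOf_iff]
      exact ⟨fun h => ⟨h, hxs⟩, fun h => h.1⟩
    rw [Finset.sum_congr rfl hx, Finset.sum_const, nsmul_eq_mul, mul_inv_cancel₀]
    have := (mem_cycleFactorsFinset_iff.1 hc).1.two_le_card_support
    positivity
  have h2 : ∑ x ∈ σ.support, (minimalPeriod σ x : ℚ)⁻¹ = σ.cycleType.card := by
    have hs : σ.support = σ.cycleFactorsFinset.biUnion support := by
      ext x
      rw [mem_support_iff_mem_support_of_mem_cycleFactorsFinset, Finset.mem_biUnion]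
    rw [hs, Finset.sum_biUnion, Finset.sum_congr rfl h1]
    · simp [cycleType_def]
    · intro c hc d hd hcd
      exact (cycleFactorsFinset_pairwise_disjoint σ hc hd hcd).disjoint_support
  have h3 : ∑ x ∈ σ.supportᶜ, (minimalPeriod σ x : ℚ)⁻¹ = (σ.supportᶜ.card : ℚ) := by
    rw [Finset.card_eq_sum_ones, Nat.cast_sum]
    refine Finset.sum_congr rfl fun x hx => ?_
    rw [minimalPeriod_eq_one_iff_isFixedPt.2]
    · simp
    · simpa [IsFixedPt] using hx
  have h4 := numCycles_eq_sum σ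
  rw [← Finset.sum_add_sum_compl σ.support, h2, h3] at h4
  have h5 : numCycles σ = σ.cycleType.card + σ.supportᶜ.card := by exact_mod_cast h4
  rw [sum_cycleType, h5, ← Finset.card_add_card_compl σ.support]
  ring

theorem sign_eq_neg_one_pow [Fintype D] [DecidableEq D] (σ : Perm D) :
    sign σ = (-1) ^ (Fintype.card D + numCycles σ) := by
  rw [sign_of_cycleType]
  have h := numCycles_add_card_support σ
  refine neg_one_pow_congr ?_
  rw [Nat.even_iff, Nat.even_iff]
  omega

theorem minimalPeriod_eq_of_injective {E : Type*} {σ : D → D} {τ : E → E} {f : D → E}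
    (hf : Injective f) (h : Semiconj f σ τ) (x : D) :
    minimalPeriod σ x = minimalPeriod τ (f x) := by
  rw [minimalPeriod_eq_minimalPeriod_iff]
  intro n
  rw [IsPeriodicPt, IsPeriodicPt, IsFixedPt, IsFixedPt, ← hf.eq_iff, h.iterate_right n x]

end Equiv.Perm

/-! ### Functions constant on cycles, and their coboundaries. -/

namespace Equiv.Perm

open Function

variable {D : Type*}

/-- The rational functions that are constant on the cycles of a permutation. -/
def invariantFunctions (σ : Perm D) : Submodule ℚ (D → ℚ) where
  carrier := {f | ∀ x, f (σ x) = f x}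
  add_mem' hf hg x := by simp [hf x, hg x]
  zero_mem' x := rfl
  smul_mem' c f hf x := by simp [hf x]

theorem eq_of_sameCycle_of_mem_invariantFunctions {σ : Perm D} {f : D → ℚ}
    (hf : f ∈ σ.invariantFunctions) {x y : D} (h : σ.SameCycle x y) : f x = f y := by
  obtain ⟨n, rfl⟩ := h
  induction n with
  | zero => rfl
  | succ n ih => rw [ih, add_comm, zpow_add, mul_apply, zpow_one, hf]
  | pred n ih =>
    rw [ih, ← hf ((σ ^ (-(n : ℤ) - 1)) x), ← mul_apply, ← zpow_one_add]
    congr 3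
    ring

/-- Invariant functions are the functions on the set of cycles. -/
def invariantFunctionsEquiv (σ : Perm D) :
    (Quotient (SameCycle.setoid σ) → ℚ) ≃ₗ[ℚ] σ.invariantFunctions where
  toFun g := ⟨fun x => g (Quotient.mk _ x), fun x => congrArg g
    (Quotient.sound (sameCycle_apply_left.2 (SameCycle.refl σ x)))⟩
  map_add' _ _ := rfl
  map_smul' _ _ := rfl
  invFun f := Quotient.lift f.1 fun _ _ h => eq_of_sameCycle_of_mem_invariantFunctions f.2 h
  left_inv g := by
    ext q
    induction q using Quotient.inductionOn
    rfl
  right_inv _ := rfl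

theorem finrank_invariantFunctions [Finite D] (σ : Perm D) :
    Module.finrank ℚ σ.invariantFunctions = numCycles σ := by
  have := Fintype.ofFinite (Quotient (SameCycle.setoid σ))
  rw [← σ.invariantFunctionsEquiv.finrank_eq, Module.finrank_fintype_fun_eq_card, numCycles,
    Nat.card_eq_fintype_card]

/-- The coboundary operator `f ↦ f ∘ α - f`. -/
def coboundary (α : Perm D) : (D → ℚ) →ₗ[ℚ] (D → ℚ) := LinearMap.funLeft ℚ ℚ α - LinearMap.id

theorem coboundary_apply (α : Perm D) (f : D → ℚ) (x : D) :
    α.coboundary f x = f (α x) - f x := rfl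

/-- Rank-nullity: the kernel of the coboundary on σ-invariant functions consists of functions
invariant under both permutations, and these are constant by `h`. -/
theorem numCycles_le_finrank_map_coboundary [Finite D] (σ α : Perm D)
    (h : ∀ f : D → ℚ, (∀ x, f (σ x) = f x) → (∀ x, f (α x) = f x) → ∀ x y, f x = f y) :
    numCycles σ ≤ Module.finrank ℚ (σ.invariantFunctions.map α.coboundary) + 1 := by
  have hrk := (α.coboundary.domRestrict σ.invariantFunctions).finrank_range_add_finrank_ker
  rw [finrank_invariantFunctions, LinearMap.range_domRestrict] at hrk
  have hker : Module.finrank ℚ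
      (LinearMap.ker (α.coboundary.domRestrict σ.invariantFunctions)) ≤ 1 := by
    have hconst : ∀ f : LinearMap.ker (α.coboundary.domRestrict σ.invariantFunctions),
        ∀ x y, f.1.1 x = f.1.1 y := fun f => h f.1.1 f.1.2 fun x => by
      have := congrFun (LinearMap.mem_ker.1 f.2) x
      rw [LinearMap.domRestrict_apply, coboundary_apply] at this
      exact sub_eq_zero.1 this
    cases isEmpty_or_nonempty D with
    | inl hD =>
      refine (finrank_le_one 0 fun w => ⟨0, ?_⟩)
      ext x
      exact hD.elim x
    | inr hD =>
      obtain ⟨x₀⟩ := hD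
      refine (finrank_le_one ⟨⟨fun _ => 1, fun _ => rfl⟩, ?_⟩ fun w => ⟨w.1.1 x₀, ?_⟩)
      · ext x
        simp [coboundary_apply]
      · ext x
        simp [hconst w x₀ x]
  omega

end Equiv.Perm

/-! ### The Euler characteristic of a map is at most two, and even. -/

namespace OrientedMap

open Equiv.Perm Function

variable (M : OrientedMap.{u})

instance : Finite M.Dart := M.finite_dart
instance : Nonempty M.Dart := M.nonempty_dart

theorem card_vertex : Nat.card M.Vertex = numCycles M.rot := rfl
theorem card_edge : Nat.card M.Edge = numCycles M.rev := rfl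
theorem card_face : Nat.card M.Face = numCycles M.next := rfl

theorem next_apply (d : M.Dart) : M.next d = M.rot⁻¹ (M.rev d) := rfl

theorem rot_next (d : M.Dart) : M.rot (M.next d) = M.rev d := by
  simp [next_apply]

theorem minimalPeriod_rev (d : M.Dart) : minimalPeriod M.rev d = 2 := by
  have h : IsPeriodicPt M.rev 2 d := M.rev_rev d
  refine ((Nat.dvd_prime Nat.prime_two).1 h.minimalPeriod_dvd).resolve_left fun h1 => ?_
  exact M.rev_ne d (minimalPeriod_eq_one_iff_isFixedPt.1 h1)

theorem two_mul_card_edge : 2 * Nat.card M.Edge = Nat.card M.Dart := by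
  have := Fintype.ofFinite M.Dart
  have h := numCycles_eq_sum M.rev
  simp only [minimalPeriod_rev, Finset.sum_const, Finset.card_univ, nsmul_eq_mul] at h
  rw [card_edge, Nat.card_eq_fintype_card]
  have h2 : (2 * numCycles M.rev : ℚ) = Fintype.card M.Dart := by
    rw [h]
    push_cast
    ring
  exact_mod_cast h2

theorem forall_of_closed {p : M.Dart → Prop} (hrot : ∀ d, p (M.rot d) ↔ p d)
    (hrev : ∀ d, p (M.rev d) ↔ p d) {d : M.Dart} (hd : p d) (e : M.Dart) : p e := by
  obtain ⟨g, hg, rfl⟩ := M.connected d e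
  have : ∀ d, p (g d) ↔ p d := by
    induction hg using Subgroup.closure_induction with
    | mem g hg =>
      rcases hg with rfl | rfl
      exacts [hrot, hrev]
    | one => exact fun _ => Iff.rfl
    | mul g h _ _ hg hh => exact fun d => (hg _).trans (hh d)
    | inv g _ hg => exact fun d => by rw [← hg, ← mul_apply, mul_inv_cancel, one_apply]
  exact (this d).2 hd

theorem constant_of_invariant {β : Type*} {f : M.Dart → β} (hrot : ∀ d, f (M.rot d) = f d)
    (hrev : ∀ d, f (M.rev d) = f d) (d e : M.Dart) : f d = f e :=
  (M.forall_of_closed (p := fun x => f x = f d) (fun x => by rw [hrot]) (fun x => by rw [hrev])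
    rfl e).symm

/-- Coboundaries of vertex functions and of face functions are orthogonal. Since `rev d` and `next
d` share their origin, reindexing along `next` or `rev` makes all four sums in the expanded product
equal, and they cancel. -/
theorem sum_coboundary_mul_coboundary [Fintype M.Dart] {f g : M.Dart → ℚ}
    (hf : f ∈ invariantFunctions M.rot) (hg : g ∈ invariantFunctions M.next) :
    ∑ d, coboundary M.rev f d * coboundary M.rev g d = 0 := by
  have h1 : ∑ d, f (M.rev d) * g (M.rev d) = ∑ d, f d * g d :=
    Equiv.sum_comp M.rev fun d => f d * g d
  have h2 : ∀ d, f (M.rev d) = f (M.next d) := fun d => by rw [← rot_next, hf]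
  have h3 : ∑ d, f (M.rev d) * g d = ∑ d, f d * g d := by
    rw [← Equiv.sum_comp M.next fun d => f d * g d]
    exact Finset.sum_congr rfl fun d _ => by rw [h2, hg]
  have h4 : ∑ d, f d * g (M.rev d) = ∑ d, f (M.rev d) * g d := by
    rw [← Equiv.sum_comp M.rev fun d => f (M.rev d) * g d]
    exact Finset.sum_congr rfl fun d _ => by rw [M.rev_rev]
  simp only [coboundary_apply, sub_mul, mul_sub, Finset.sum_sub_distrib, h1, h3, h4]
  ring

/-- The genus of a closed oriented surface is not negative. -/
theorem eulerChar_le_two :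
    (Nat.card M.Vertex : ℤ) - Nat.card M.Edge + Nat.card M.Face ≤ 2 := by
  classical
  have := Fintype.ofFinite M.Dart
  set U₁ := (invariantFunctions M.rot).map (coboundary M.rev) with hU₁
  set U₂ := (invariantFunctions M.next).map (coboundary M.rev) with hU₂
  have h1 := numCycles_le_finrank_map_coboundary M.rot M.rev
    fun f hrot hrev => M.constant_of_invariant hrot hrev
  have h2 := numCycles_le_finrank_map_coboundary M.next M.rev fun f hnext hrev =>
    M.constant_of_invariant (fun d => by
      have := hnext (M.rev (M.rot d))
      simpa [next_apply, M.rev_rev, hrev] using this.symm) hrev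
  -- A common element is orthogonal to itself, hence zero over ℚ.
  have hdisj : U₁ ⊓ U₂ = ⊥ := by
    rw [eq_bot_iff]
    rintro h ⟨⟨f, hf, rfl⟩, ⟨g, hg, hfg⟩⟩
    have hs := M.sum_coboundary_mul_coboundary hf hg
    rw [hfg, Finset.sum_eq_zero_iff_of_nonneg fun _ _ => mul_self_nonneg _] at hs
    ext d
    exact mul_self_eq_zero.1 (hs d (Finset.mem_univ d))
  have hanti : ∀ h ∈ U₁ ⊔ U₂, ∀ d, h (M.rev d) = -h d := by
    intro h hh d
    obtain ⟨_, ⟨f, -, rfl⟩, _, ⟨g, -, rfl⟩, rfl⟩ := Submodule.mem_sup.1 hh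
    simp only [Pi.add_apply, coboundary_apply, M.rev_rev]
    ring
  -- Coboundaries are antisymmetric under `rev`. As the `rev`-invariant functions have dimension E
  -- in a space of dimension 2E, this leaves (V - 1) + (F - 1) ≤ E.
  have hdisj' : Disjoint (U₁ ⊔ U₂) (invariantFunctions M.rev) := by
    rw [Submodule.disjoint_def]
    intro h hh hrev
    ext d
    have h3 := hanti h hh d
    rw [hrev d] at h3
    simpa using self_eq_neg.1 h3
  have h3 := Submodule.finrank_sup_add_finrank_inf_eq U₁ U₂
  have h4 := Submodule.finrank_add_finrank_le_of_disjoint hdisj'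
  rw [hdisj, finrank_bot] at h3
  rw [finrank_invariantFunctions, Module.finrank_fintype_fun_eq_card,
    ← Nat.card_eq_fintype_card, ← two_mul_card_edge, ← card_edge] at h4
  rw [← card_vertex, ← hU₁] at h1
  rw [← card_face, ← hU₂] at h2
  omega

/-- The Euler characteristic of a closed oriented surface is even. -/
theorem even_eulerChar :
    Even ((Nat.card M.Vertex : ℤ) - Nat.card M.Edge + Nat.card M.Face) := by
  classical
  have := Fintype.ofFinite M.Dart
  have h : sign M.next * sign M.rot = sign M.rev := by
    rw [next, Equiv.Perm.sign_mul, sign_inv, mul_right_comm, Int.units_mul_self, one_mul]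
  rw [sign_eq_neg_one_pow, sign_eq_neg_one_pow, sign_eq_neg_one_pow, ← pow_add] at h
  have h2 := M.two_mul_card_edge
  rw [Nat.card_eq_fintype_card (α := M.Dart)] at h2
  rw [← card_vertex, ← card_edge, ← card_face, ← h2] at h
  have h3 : Even (2 * Nat.card M.Edge + Nat.card M.Face + (2 * Nat.card M.Edge + Nat.card M.Vertex)
      + (2 * Nat.card M.Edge + Nat.card M.Edge)) := by
    rw [← neg_one_pow_eq_one_iff_even (R := ℤˣ) (by decide), pow_add, h, Int.units_mul_self]
  rw [Nat.even_iff] at h3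
  rw [Int.even_iff]
  omega

end OrientedMap

/-! ### Morphisms of maps, their degree, and the fibre product. -/

namespace OrientedMap

open Equiv.Perm Function

theorem valence_eq (M : OrientedMap.{u}) (d : M.Dart) : M.valence d = minimalPeriod M.rot d := rfl

theorem faceDegree_eq (M : OrientedMap.{u}) (d : M.Dart) :
    M.faceDegree d = minimalPeriod M.next d := rfl

/-- Maps between the dart sets that commute with rotation and reversal. -/
structure Hom (M N : OrientedMap.{u}) where
  /-- the action on darts -/
  toFun : M.Dart → N.Dart
  map_rot : ∀ d, toFun (M.rot d) = N.rot (toFun d)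
  map_rev : ∀ d, toFun (M.rev d) = N.rev (toFun d)

namespace Hom

variable {M N : OrientedMap.{u}} (f : Hom M N)

theorem map_next (d : M.Dart) : f.toFun (M.next d) = N.next (f.toFun d) := by
  apply N.rot.injective
  rw [← f.map_rot, rot_next, rot_next, f.map_rev]

/-- The number of darts over a given dart. -/
noncomputable def fiberCard (e : N.Dart) : ℕ := Nat.card {d // f.toFun d = e}

/-- `rot` and `rev` carry fibres bijectively to fibres, and the target is connected; so every
morphism has a degree, and is surjective. -/
theorem fiberCard_eq (e e' : N.Dart) : f.fiberCard e = f.fiberCard e' := by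
  refine N.constant_of_invariant (f := f.fiberCard) (fun e => ?_) (fun e => ?_) e e'
  · exact (Nat.card_congr (M.rot.subtypeEquiv fun d => by
      rw [f.map_rot, N.rot.injective.eq_iff])).symm
  · exact (Nat.card_congr (M.rev.subtypeEquiv fun d => by
      rw [f.map_rev, N.rev.injective.eq_iff])).symm

theorem fiberCard_pos (e : N.Dart) : 0 < f.fiberCard e := by
  obtain ⟨d⟩ := M.nonempty_dart
  rw [f.fiberCard_eq e (f.toFun d)]
  have : Nonempty {d' // f.toFun d' = f.toFun d} := ⟨⟨d, rfl⟩⟩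
  exact Nat.card_pos

theorem surjective : Surjective f.toFun := fun e => by
  have := (Nat.card_pos_iff.1 (f.fiberCard_pos e)).1
  obtain ⟨d, hd⟩ := this
  exact ⟨d, hd⟩

theorem injective_of_fiberCard_le_one {e₀ : N.Dart} (h : f.fiberCard e₀ ≤ 1) :
    Injective f.toFun := fun d d' hd => by
  rw [f.fiberCard_eq e₀ (f.toFun d')] at h
  have := Finite.card_le_one_iff_subsingleton.1 h
  exact congrArg Subtype.val
    (Subsingleton.elim (α := {x // f.toFun x = f.toFun d'}) ⟨d, hd⟩ ⟨d', rfl⟩)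

theorem numCycles_eq_mul {σ : Equiv.Perm M.Dart} {τ : Equiv.Perm N.Dart}
    (h : ∀ d, minimalPeriod σ d = minimalPeriod τ (f.toFun d)) (e₀ : N.Dart) :
    numCycles σ = f.fiberCard e₀ * numCycles τ := by
  classical
  have := Fintype.ofFinite M.Dart
  have := Fintype.ofFinite N.Dart
  have h1 : (numCycles σ : ℚ) = f.fiberCard e₀ * numCycles τ := by
    rw [numCycles_eq_sum, numCycles_eq_sum, Finset.mul_sum, ← Finset.sum_fiberwise (g := f.toFun)]
    refine Finset.sum_congr rfl fun e _ => ?_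
    rw [Finset.sum_congr rfl (g := fun _ => (minimalPeriod τ e : ℚ)⁻¹), Finset.sum_const,
      nsmul_eq_mul, f.fiberCard_eq e₀ e, fiberCard, Nat.card_eq_fintype_card, Fintype.card_subtype]
    intro d hd
    rw [h, (Finset.mem_filter.1 hd).2]
  exact_mod_cast h1

theorem card_edge_eq_mul (e₀ : N.Dart) :
    Nat.card M.Edge = f.fiberCard e₀ * Nat.card N.Edge :=
  f.numCycles_eq_mul (fun d => by rw [minimalPeriod_rev, minimalPeriod_rev]) e₀

/-- The sphere has no unbranched coverings other than homeomorphisms. -/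
theorem injective_of_unbranched (hN : N.IsSpherical)
    (hv : ∀ d, M.valence d = N.valence (f.toFun d))
    (hf : ∀ d, M.faceDegree d = N.faceDegree (f.toFun d)) : Injective f.toFun := by
  obtain ⟨e₀⟩ := N.nonempty_dart
  refine f.injective_of_fiberCard_le_one (e₀ := e₀) ?_
  have h1 := M.eulerChar_le_two
  have h2 : Nat.card M.Vertex = _ * Nat.card N.Vertex := f.numCycles_eq_mul hv e₀
  have h3 : Nat.card M.Face = _ * Nat.card N.Face := f.numCycles_eq_mul hf e₀
  rw [h2, h3, f.card_edge_eq_mul e₀] at h1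
  unfold IsSpherical at hN
  push_cast at h1
  -- The Euler characteristic multiplies by the degree. The source need not be known to be a sphere:
  -- the bound χ ≤ 2 suffices.
  have h4 : (f.fiberCard e₀ : ℤ) * 2 ≤ 2 := by
    rw [← hN]
    linarith
  omega

end Hom

section Component

variable {D : Type u} (rot rev : Equiv.Perm D) (d₀ : D)

/-- The permutation induced on the orbit of a point. -/
def orbitPerm (g : Equiv.Perm D) (hg : g ∈ Subgroup.closure {rot, rev}) :
    Equiv.Perm {d : D // ∃ h ∈ Subgroup.closure {rot, rev}, h d₀ = d} :=
  g.subtypePerm fun d => by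
    constructor
    · rintro ⟨h, hh, hd⟩
      exact ⟨g⁻¹ * h, mul_mem (inv_mem hg) hh, by simp [hd]⟩
    · rintro ⟨h, hh, rfl⟩
      exact ⟨g * h, mul_mem hg hh, rfl⟩

theorem orbitPerm_connected (d e : {d : D // ∃ h ∈ Subgroup.closure {rot, rev}, h d₀ = d}) :
    ∃ g ∈ Subgroup.closure {orbitPerm rot rev d₀ rot (Subgroup.subset_closure (Or.inl rfl)),
      orbitPerm rot rev d₀ rev (Subgroup.subset_closure (Or.inr rfl))}, g d = e := by
  have lift : ∀ g ∈ Subgroup.closure {rot, rev}, ∃ g' ∈ Subgroup.closure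
      {orbitPerm rot rev d₀ rot (Subgroup.subset_closure (Or.inl rfl)),
      orbitPerm rot rev d₀ rev (Subgroup.subset_closure (Or.inr rfl))}, ∀ d, (g' d).1 = g d.1 := by
    intro g hg
    induction hg using Subgroup.closure_induction with
    | mem g hg =>
      rcases hg with rfl | rfl
      · exact ⟨_, Subgroup.subset_closure (Or.inl rfl), fun _ => rfl⟩
      · exact ⟨_, Subgroup.subset_closure (Or.inr rfl), fun _ => rfl⟩
    | one => exact ⟨1, one_mem _, fun _ => rfl⟩
    | mul g h _ _ hg hh =>
      obtain ⟨g', hg', hg⟩ := hg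
      obtain ⟨h', hh', hh⟩ := hh
      exact ⟨g' * h', mul_mem hg' hh', fun d => by simp [hg, hh]⟩
    | inv g _ hg =>
      obtain ⟨g', hg', hg⟩ := hg
      refine ⟨g'⁻¹, inv_mem hg', fun d => ?_⟩
      rw [← g.injective.eq_iff, ← hg]
      simp
  obtain ⟨d, g, hg, rfl⟩ := d
  obtain ⟨e, h, hh, rfl⟩ := e
  obtain ⟨x, hx, hx'⟩ := lift (h * g⁻¹) (mul_mem hh (inv_mem hg))
  exact ⟨x, hx, Subtype.ext (by simp [hx'])⟩

/-- The connected component of a dart in a possibly disconnected map. -/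
def component [Finite D] (rev_rev : ∀ d, rev (rev d) = d) (rev_ne : ∀ d, rev d ≠ d) :
    OrientedMap.{u} where
  Dart := {d : D // ∃ g ∈ Subgroup.closure {rot, rev}, g d₀ = d}
  finite_dart := inferInstance
  nonempty_dart := ⟨⟨d₀, 1, one_mem _, rfl⟩⟩
  rot := orbitPerm rot rev d₀ rot (Subgroup.subset_closure (Or.inl rfl))
  rev := orbitPerm rot rev d₀ rev (Subgroup.subset_closure (Or.inr rfl))
  rev_rev d := Subtype.ext (rev_rev d)
  rev_ne d h := rev_ne d (congrArg Subtype.val h)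
  connected := orbitPerm_connected rot rev d₀

end Component

/-- A sphere maps to every map whose vertices and faces are sufficiently small. -/
theorem IsSpherical.exists_hom {M N : OrientedMap.{u}} (hM : M.IsSpherical)
    (R : M.Dart → N.Dart → Prop) {d₀ : M.Dart} {e₀ : N.Dart} (h₀ : R d₀ e₀)
    (hrot : ∀ d e, R (M.rot d) (N.rot e) ↔ R d e) (hrev : ∀ d e, R (M.rev d) (N.rev e) ↔ R d e)
    (hv : ∀ d e, R d e → N.valence e ∣ M.valence d)
    (hf : ∀ d e, R d e → N.faceDegree e ∣ M.faceDegree d) :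
    ∃ f : Hom M N, ∀ d, R d (f.toFun d) := by
  let P := component (M.rot.prodCongr N.rot) (M.rev.prodCongr N.rev) (d₀, e₀)
    (fun d => Prod.ext (M.rev_rev _) (N.rev_rev _))
    (fun d h => M.rev_ne _ (congrArg Prod.fst h))
  let p : Hom P M := ⟨fun x => x.1.1, fun _ => rfl, fun _ => rfl⟩
  let q : Hom P N := ⟨fun x => x.1.2, fun _ => rfl, fun _ => rfl⟩
  have hR : ∀ x : P.Dart, R (p.toFun x) (q.toFun x) :=
    P.forall_of_closed (p := fun x => R (p.toFun x) (q.toFun x)) (fun x => hrot _ _)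
      (fun x => hrev _ _) (d := ⟨(d₀, e₀), 1, one_mem _, rfl⟩) h₀
  -- The period of a pair is the lcm of the two periods, so divisibility leaves the period in `M`:
  -- the projection to `M` is unbranched.
  have key : ∀ (σ : Equiv.Perm P.Dart) (τ : Equiv.Perm M.Dart) (υ : Equiv.Perm N.Dart)
      (_ : ∀ x, p.toFun (σ x) = τ (p.toFun x)) (_ : ∀ x, q.toFun (σ x) = υ (q.toFun x)) (x : P.Dart),
      minimalPeriod υ (q.toFun x) ∣ minimalPeriod τ (p.toFun x) →
      minimalPeriod σ x = minimalPeriod τ (p.toFun x) := by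
    intro σ τ υ hp hq x hx
    refine Nat.dvd_antisymm (IsPeriodicPt.minimalPeriod_dvd ?_)
      (((isPeriodicPt_minimalPeriod σ x).map hp).minimalPeriod_dvd)
    have h1 : Semiconj p.toFun σ τ := hp
    have h2 : Semiconj q.toFun σ υ := hq
    refine Subtype.ext (Prod.ext ?_ ?_)
    · exact (h1.iterate_right _ x).trans (iterate_minimalPeriod (f := τ))
    · exact (h2.iterate_right _ x).trans (isPeriodicPt_iff_minimalPeriod_dvd.2 hx)
  have hinj : Injective p.toFun := p.injective_of_unbranched hM
    (fun x => key _ _ _ p.map_rot q.map_rot x (hv _ _ (hR x)))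
    (fun x => key _ _ _ p.map_next q.map_next x (hf _ _ (hR x)))
  let s := Equiv.ofBijective p.toFun ⟨hinj, p.surjective⟩
  have hs : ∀ d, p.toFun (s.symm d) = d := s.apply_symm_apply
  have hs' : ∀ x, s.symm (p.toFun x) = x := s.symm_apply_apply
  refine ⟨⟨fun d => q.toFun (s.symm d), fun d => ?_, fun d => ?_⟩, fun d => ?_⟩
  · rw [← q.map_rot, ← hs' (P.rot _), p.map_rot, hs]
  · rw [← q.map_rev, ← hs' (P.rev _), p.map_rev, hs]
  · simpa only [hs] using hR (s.symm d)

end OrientedMap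

/-! ### Gradings of the darts by ℤ/3, and the patterns they define. -/

namespace OrientedMap

open Equiv.Perm Function

/-- A labelling of the darts that is cyclic around vertices and compatible with reversal. In a
football pattern with `n = 2` the labels `0`, `1`, `2` stand for the darts with a black face on the
left, with a black face on the right, and with no black face on either side. -/
structure IsGrading (M : OrientedMap.{u}) (s : M.Dart → ZMod 3) : Prop where
  map_rot : ∀ d, s (M.rot d) = s d + 1
  map_rev : ∀ d, s (M.rev d) = 1 - s d

namespace IsGrading

variable {M : OrientedMap.{u}} {s : M.Dart → ZMod 3} (hs : M.IsGrading s)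
include hs

/-- This makes label 0 constant along a face, while 1 and 2 alternate along the others. -/
theorem map_next (d : M.Dart) : s (M.next d) = -s d := by
  have h := hs.map_rot (M.next d)
  rw [rot_next, hs.map_rev] at h
  linear_combination -h

theorem map_next_pow (j : ℕ) (d : M.Dart) : s ((M.next ^ j) d) = (-1) ^ j * s d := by
  induction j with
  | zero => simp
  | succ j ih => rw [pow_succ', mul_apply, hs.map_next, ih, pow_succ]; ring

theorem map_rot_pow (j : ℕ) (d : M.Dart) : s ((M.rot ^ j) d) = s d + j := by
  induction j with
  | zero => simp
  | succ j ih => rw [pow_succ', mul_apply, hs.map_rot, ih]; push_cast; ring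

theorem three_dvd_valence (d : M.Dart) : 3 ∣ M.valence d := by
  have h := hs.map_rot_pow (M.valence d) d
  rw [← iterate_eq_pow, valence_eq, iterate_minimalPeriod] at h
  rw [← ZMod.natCast_eq_zero_iff, valence_eq]
  simpa using h

/-- Rotation permutes the three label classes cyclically, so each holds a third of the darts. -/
theorem sum_comp [Fintype M.Dart] (g : ZMod 3 → ℚ) :
    3 * ∑ d, g (s d) = Fintype.card M.Dart * (g 0 + g 1 + g 2) := by
  have h1 : ∑ d, g (s d + 1) = ∑ d, g (s d) := by
    rw [← Equiv.sum_comp M.rot fun d => g (s d)]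
    simp only [hs.map_rot]
  have h2 : ∑ d, g (s d + 2) = ∑ d, g (s d) := by
    rw [← h1, ← Equiv.sum_comp M.rot fun d => g (s d + 1)]
    simp only [hs.map_rot, add_assoc, one_add_one_eq_two]
  have h3 : ∀ i : ZMod 3, g i + g (i + 1) + g (i + 2) = g 0 + g 1 + g 2 := by
    intro i
    fin_cases i
    · rfl
    · change g 1 + g 2 + g 0 = _
      ring
    · change g 2 + g 0 + g 1 = _
      ring
  calc 3 * ∑ d, g (s d) = ∑ d, (g (s d) + g (s d + 1) + g (s d + 2)) := by
        rw [Finset.sum_add_distrib, Finset.sum_add_distrib, h1, h2]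
        ring
    _ = _ := by simp only [h3, Finset.sum_const, Finset.card_univ, nsmul_eq_mul]

theorem card_face_eq {k l : ℕ} (hf : ∀ d, M.faceDegree d = if s d = 0 then k else l) :
    (Nat.card M.Face : ℚ) = Nat.card M.Dart / 3 * (1 / k + 2 / l) := by
  have := Fintype.ofFinite M.Dart
  have h1 := numCycles_eq_sum M.next
  have h2 := hs.sum_comp fun i => ((if i = 0 then k else l : ℕ) : ℚ)⁻¹
  simp only [← hf, faceDegree_eq] at h2
  rw [← h1, if_pos trivial, if_neg (by decide), if_neg (by decide)] at h2
  rw [card_face, Nat.card_eq_fintype_card]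
  linear_combination h2 / 3

end IsGrading

theorem card_vertex_le (M : OrientedMap.{u}) (h : ∀ d, 3 ≤ M.valence d) :
    (Nat.card M.Vertex : ℚ) ≤ Nat.card M.Dart / 3 := by
  have := Fintype.ofFinite M.Dart
  rw [card_vertex, numCycles_eq_sum]
  calc ∑ d, (minimalPeriod M.rot d : ℚ)⁻¹ ≤ ∑ d : M.Dart, (3 : ℚ)⁻¹ := by
        refine Finset.sum_le_sum fun d _ => inv_anti₀ (by norm_num) ?_
        exact_mod_cast h d
    _ = _ := by simp [div_eq_mul_inv]

theorem card_vertex_eq (M : OrientedMap.{u}) (h : ∀ d, M.valence d = 3) :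
    (Nat.card M.Vertex : ℚ) = Nat.card M.Dart / 3 := by
  have := Fintype.ofFinite M.Dart
  rw [card_vertex, numCycles_eq_sum]
  simp only [valence_eq] at h
  simp [h, div_eq_mul_inv]

/-- The only positive even integer not exceeding 2 is 2. -/
theorem isSpherical_of_eulerChar_pos (M : OrientedMap.{u})
    (h : 0 < (Nat.card M.Vertex : ℤ) - Nat.card M.Edge + Nat.card M.Face) : M.IsSpherical := by
  obtain ⟨r, hr⟩ := M.even_eulerChar
  have h2 := M.eulerChar_le_two
  unfold IsSpherical
  omega

/-- The black and white painting determined by a grading. -/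
def paint (M : OrientedMap.{u}) (s : M.Dart → ZMod 3) : PaintedMap.{u} where
  toOrientedMap := M
  black := {F | ∃ d, M.face d = F ∧ s d = 0}

theorem IsGrading.isBlack_paint {M : OrientedMap.{u}} {s : M.Dart → ZMod 3} (hs : M.IsGrading s)
    (d : M.Dart) : (M.paint s).IsBlack d ↔ s d = 0 := by
  constructor
  · rintro ⟨e, he, hse⟩
    have h : M.next.SameCycle e d := Quotient.exact he
    obtain ⟨j, rfl⟩ := h.exists_nat_pow_eq
    rw [hs.map_next_pow, hse, mul_zero]
  · exact fun h => ⟨d, rfl, h⟩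

theorem IsGrading.isFootballPattern_paint {M : OrientedMap.{u}} {s : M.Dart → ZMod 3}
    (hs : M.IsGrading s) {k l : ℕ} (hM : M.IsSpherical) (hv : ∀ d, M.valence d = 3)
    (hf : ∀ d, M.faceDegree d = if s d = 0 then k else l) :
    (M.paint s).IsFootballPattern k l 2 where
  spherical := hM
  three_le_valence d := (hv d).ge
  faceDegree_black d hd := (hf d).trans (if_pos ((hs.isBlack_paint d).1 hd))
  faceDegree_white d hd := (hf d).trans (if_neg fun h => hd ((hs.isBlack_paint d).2 h))
  black_meets d hd h := by
    have h1 := (hs.isBlack_paint _).1 h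
    have h2 := hs.map_rev d
    rw [(hs.isBlack_paint d).1 hd] at h2
    rw [show (M.paint s).rev d = M.rev d from rfl, h2] at h1
    exact absurd h1 (by decide)
  white_meets := by
    intro (d : M.Dart) hd
    have key : ∀ j, (M.paint s).IsBlack ((M.paint s).rev (((M.paint s).next ^ j) d)) ↔
        (-1) ^ j * s d = 1 := fun j => by
      refine (hs.isBlack_paint (M.rev ((M.next ^ j) d))).trans ?_
      rw [hs.map_rev, hs.map_next_pow, sub_eq_zero, eq_comm]
    simp only [key]
    have hd' : s d = 1 ∨ s d = 2 := by
      have h0 : s d ≠ 0 := fun h => hd ((hs.isBlack_paint d).2 h)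
      generalize s d = i at h0
      revert i
      decide
    rcases hd' with h | h
    -- A dart labelled 1 already has black across its edge, so the phase is 0; one labelled 2
    -- reaches label 1 after a single step, so the phase is 1.
    · refine ⟨0, fun j => ?_⟩
      rw [h]
      rcases Nat.even_or_odd j with hj | hj
      · have : j ≡ 0 [MOD 2] := Nat.even_iff.1 hj
        simp only [hj.neg_one_pow, this, one_mul]
      · have : ¬ j ≡ 0 [MOD 2] := fun h => by
          have := Nat.odd_iff.1 hj
          unfold Nat.ModEq at h
          omega
        simp only [hj.neg_one_pow, this, iff_false]
        decide
    · refine ⟨1, fun j => ?_⟩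
      rw [h]
      rcases Nat.even_or_odd j with hj | hj
      · have : ¬ j ≡ 1 [MOD 2] := fun h => by
          have := Nat.even_iff.1 hj
          unfold Nat.ModEq at h
          omega
        simp only [hj.neg_one_pow, this, iff_false]
        decide
      · have : j ≡ 1 [MOD 2] := Nat.odd_iff.1 hj
        simp only [hj.neg_one_pow, this, iff_true]
        decide

end OrientedMap

/-! ### Football patterns with n = 2 are graded. -/

namespace PaintedMap

open OrientedMap Equiv.Perm Function

theorem isBlack_next (M : PaintedMap.{u}) (d : M.Dart) : M.IsBlack (M.next d) ↔ M.IsBlack d := by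
  have : M.face (M.next d) = M.face d :=
    Quotient.sound (sameCycle_apply_left.2 (SameCycle.refl M.next d))
  rw [IsBlack, this, IsBlack]

theorem isBlack_rev_rot (M : PaintedMap.{u}) (d : M.Dart) :
    M.IsBlack (M.rev (M.rot d)) ↔ M.IsBlack d := by
  rw [← isBlack_next, next_apply, M.rev_rev]
  simp

open Classical in
/-- The label of a dart, by the colours on its left and right. -/
noncomputable def side (M : PaintedMap.{u}) (d : M.Dart) : ZMod 3 :=
  if M.IsBlack d then 0 else if M.IsBlack (M.rev d) then 1 else 2

theorem side_eq_zero_iff (M : PaintedMap.{u}) (d : M.Dart) : M.side d = 0 ↔ M.IsBlack d := by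
  unfold side
  split_ifs <;> simp_all
  decide

namespace IsFootballPattern

variable {M : PaintedMap.{u}} {k l : ℕ} (h : M.IsFootballPattern k l 2)
include h

/-- Here n = 2 enters: along a white face, black and white neighbours alternate. -/
theorem isBlack_rev_next (d : M.Dart) (hd : ¬ M.IsBlack d) :
    M.IsBlack (M.rev (M.next d)) ↔ ¬ M.IsBlack (M.rev d) := by
  obtain ⟨i, hi⟩ := h.white_meets d hd
  have h0 := hi 0
  have h1 := hi 1
  rw [pow_zero, one_apply] at h0
  rw [pow_one] at h1
  rw [h0, h1]
  unfold Nat.ModEq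
  omega

theorem isBlack_rot (d : M.Dart) :
    M.IsBlack (M.rot d) ↔ ¬ M.IsBlack d ∧ ¬ M.IsBlack (M.rev d) := by
  by_cases hd : M.IsBlack d
  · have := (h.black_meets (M.rot d)).mt (not_not.2 ((M.isBlack_rev_rot d).2 hd))
    simp [this, hd]
  -- The dart before `d` on its white face is `rev (rot d)`, so alternation compares the left of
  -- `rot d` with the right of `d`.
  · have h1 := h.isBlack_rev_next (M.rev (M.rot d)) (by rwa [isBlack_rev_rot])
    have h2 : M.next (M.rev (M.rot d)) = d := by simp [next_apply, M.rev_rev]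
    rw [h2, M.rev_rev] at h1
    tauto

theorem isGrading_side : M.IsGrading M.side where
  map_rot d := by
    have h1 := h.isBlack_rot d
    have h2 := M.isBlack_rev_rot d
    have h3 := h.black_meets d
    unfold side
    by_cases ha : M.IsBlack d <;> by_cases hb : M.IsBlack (M.rev d) <;> simp_all <;> decide
  map_rev d := by
    have h3 := h.black_meets d
    unfold side
    rw [M.rev_rev]
    by_cases ha : M.IsBlack d <;> by_cases hb : M.IsBlack (M.rev d) <;> simp_all
    decide

theorem faceDegree_eq_ite (d : M.Dart) : M.faceDegree d = if M.side d = 0 then k else l := by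
  split_ifs with hd
  · exact h.faceDegree_black d ((M.side_eq_zero_iff d).1 hd)
  · exact h.faceDegree_white d fun hb => hd ((M.side_eq_zero_iff d).2 hb)

theorem exists_isBlack : ∃ d, M.IsBlack d := by
  obtain ⟨d⟩ := M.nonempty_dart
  by_contra! hc
  have := (h.isBlack_rot d).2 ⟨hc _, hc _⟩
  exact hc _ this

/-- With V ≤ 2E/3 and F = (2E/3)(1/k + 2/l), the Euler characteristic is at most (2E/3)(1/k + 2/l -
1/2), yet it equals 2. -/
theorem half_lt : (1 / 2 : ℚ) < 1 / k + 2 / l := by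
  have h1 := h.isGrading_side.card_face_eq h.faceDegree_eq_ite
  have h2 := M.card_vertex_le h.three_le_valence
  have h3 := M.two_mul_card_edge
  have h4 : (Nat.card M.Vertex : ℚ) - Nat.card M.Edge + Nat.card M.Face = 2 := by
    have := h.spherical
    unfold IsSpherical at this
    exact_mod_cast this
  rw [← h3] at h1 h2
  push_cast at h1 h2
  by_contra! hc
  have h5 : (0 : ℚ) ≤ 2 * Nat.card M.Edge / 3 := by positivity
  have h6 := mul_le_mul_of_nonneg_left hc h5
  linarith

end IsFootballPattern

end PaintedMap

/-! ### Trivalent maps built from a group with an involution. -/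

namespace OrientedMap

open Equiv.Perm Function

/-- The rotation of darts in the trivalent map associated with a triangle group. -/
def triangleRot (G : Type u) : Equiv.Perm (G × ZMod 3) :=
  (Equiv.refl G).prodCongr (Equiv.addRight 1)

theorem triangleRot_pow {G : Type u} (j : ℕ) (x : G × ZMod 3) : (triangleRot G ^ j) x = (x.1, x.2 + j) := by
  induction j with
  | zero => simp
  | succ j ih =>
    rw [pow_succ', mul_apply, ih]
    exact Prod.ext rfl (by simp [triangleRot, add_assoc])

theorem minimalPeriod_eq_of_forall_dvd {α : Type*} {f : α → α} {x : α} {n : ℕ}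
    (h : ∀ m, IsPeriodicPt f m x ↔ n ∣ m) : minimalPeriod f x = n :=
  Nat.dvd_antisymm ((h n).2 dvd_rfl).minimalPeriod_dvd
    ((h _).1 (isPeriodicPt_minimalPeriod f x))

theorem minimalPeriod_triangleRot {G : Type u} (x : G × ZMod 3) : minimalPeriod (triangleRot G) x = 3 := by
  refine minimalPeriod_eq_of_forall_dvd fun j => ?_
  rw [IsPeriodicPt, IsFixedPt, iterate_eq_pow, triangleRot_pow, ← ZMod.natCast_eq_zero_iff]
  simp [Prod.ext_iff]

section TriangleMap

variable {G : Type u} [Group G] (a c : G)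

/-- The translations that describe the reversal of darts in `triangleRev`. -/
def triangleShift : ZMod 3 → G := ![a, a⁻¹, c]

/-- The reversal of darts in the trivalent map associated with a triangle group. -/
def triangleRev (hc : c * c = 1) : Equiv.Perm (G × ZMod 3) :=
  Function.Involutive.toPerm (fun x => (x.1 * triangleShift a c x.2, 1 - x.2)) fun x => by
    obtain ⟨g, i⟩ := x
    refine Prod.ext ?_ (sub_sub_cancel _ _)
    have : triangleShift a c i * triangleShift a c (1 - i) = 1 := by
      fin_cases i
      · exact mul_inv_cancel a
      · exact inv_mul_cancel a
      · exact hc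
    simp [mul_assoc, this]

theorem triangleRev_apply (hc : c * c = 1) (x : G × ZMod 3) :
    triangleRev a c hc x = (x.1 * triangleShift a c x.2, 1 - x.2) := rfl

theorem triangle_next_apply (hc : c * c = 1) (x : G × ZMod 3) :
    ((triangleRot G)⁻¹ * triangleRev a c hc) x = (x.1 * triangleShift a c x.2, -x.2) := by
  rw [mul_apply, inv_eq_iff_eq]
  exact Prod.ext rfl (by simp [triangleRot, triangleRev_apply, sub_eq_add_neg, add_comm])

theorem minimalPeriod_triangle_next_zero (hc : c * c = 1) (g : G) :
    minimalPeriod ((triangleRot G)⁻¹ * triangleRev a c hc) (g, 0) = orderOf a := by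
  have key : ∀ j : ℕ, (((triangleRot G)⁻¹ * triangleRev a c hc) ^ j) (g, 0) = (g * a ^ j, 0) := by
    intro j
    induction j with
    | zero => simp
    | succ j ih =>
      rw [pow_succ', mul_apply, ih, triangle_next_apply, pow_succ, ← mul_assoc]
      exact Prod.ext rfl neg_zero
  refine minimalPeriod_eq_of_forall_dvd fun j => ?_
  rw [IsPeriodicPt, IsFixedPt, iterate_eq_pow, key, orderOf_dvd_iff_pow_eq_one]
  simp [Prod.ext_iff]

/-- Two steps lead from label 1 through 2 back to 1, multiplying by `a⁻¹` and then by `c`; an odd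
number of steps ends at label 2. -/
theorem minimalPeriod_triangle_next_one (hc : c * c = 1) (g : G) :
    minimalPeriod ((triangleRot G)⁻¹ * triangleRev a c hc) (g, 1) = 2 * orderOf (a⁻¹ * c) := by
  have key : ∀ j : ℕ, (((triangleRot G)⁻¹ * triangleRev a c hc) ^ (2 * j)) (g, 1) =
      (g * (a⁻¹ * c) ^ j, 1) := by
    intro j
    induction j with
    | zero => simp
    | succ j ih =>
      rw [mul_add, add_comm, pow_add, mul_apply, ih, mul_one, pow_two, mul_apply,
        triangle_next_apply, triangle_next_apply, pow_succ, ← mul_assoc, ← mul_assoc]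
      rfl
  refine minimalPeriod_eq_of_forall_dvd fun n => ?_
  rw [IsPeriodicPt, IsFixedPt, iterate_eq_pow]
  obtain ⟨j, rfl | rfl⟩ := n.even_or_odd'
  · rw [key, Nat.mul_dvd_mul_iff_left two_pos, orderOf_dvd_iff_pow_eq_one]
    simp [Prod.ext_iff]
  · rw [pow_succ', mul_apply, key, triangle_next_apply]
    constructor
    · intro h
      exact absurd (congrArg Prod.snd h) (by decide : ¬ (-1 : ZMod 3) = 1)
    · intro h
      have := (dvd_mul_right 2 _).trans h
      omega

/-- One step leads to `(g * c, 1)`, and the period is constant along a cycle. -/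
theorem minimalPeriod_triangle_next_two [Finite G] (hc : c * c = 1) (g : G) :
    minimalPeriod ((triangleRot G)⁻¹ * triangleRev a c hc) (g, 2) = 2 * orderOf (a⁻¹ * c) := by
  rw [← minimalPeriod_triangle_next_one a c hc (g * c), ← minimalPeriod_apply
    (minimalPeriod_pos_iff_mem_periodicPts.1 (minimalPeriod_pos _ (g, 2))), triangle_next_apply]
  rfl

/-- A component of the trivalent map associated with two elements of a group, one of which is an
involution. -/
def triangleMap [Finite G] (hc : c * c = 1) (hc1 : c ≠ 1) : OrientedMap.{u} :=
  component (triangleRot G) (triangleRev a c hc) (1, 0)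
    (fun x => (triangleRev a c hc).symm_apply_apply x)
    -- Reversal changes the labels 0 and 1; it fixes label 2, where `c ≠ 1` moves the group element
    -- instead.
    (fun x hx => by
      obtain ⟨g, i⟩ := x
      have h1 := congrArg Prod.fst hx
      have h2 := congrArg Prod.snd hx
      rw [triangleRev_apply] at h1 h2
      fin_cases i
      · exact absurd h2 (by decide : ¬ (1 - 0 : ZMod 3) = 0)
      · exact absurd h2 (by decide : ¬ (1 - 1 : ZMod 3) = 1)
      · exact hc1 (mul_eq_left.1 h1))

variable [Finite G] (hc : c * c = 1) (hc1 : c ≠ 1)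

/-- The grading of `triangleMap`. -/
def triangleGrading (d : (triangleMap a c hc hc1).Dart) : ZMod 3 := d.1.2

theorem isGrading_triangleGrading :
    (triangleMap a c hc hc1).IsGrading (triangleGrading a c hc hc1) where
  map_rot _ := rfl
  map_rev _ := rfl

theorem valence_triangleMap (d : (triangleMap a c hc hc1).Dart) :
    (triangleMap a c hc hc1).valence d = 3 := by
  rw [valence_eq, ← minimalPeriod_triangleRot d.1]
  exact minimalPeriod_eq_of_injective Subtype.val_injective (fun _ => rfl) d

theorem faceDegree_triangleMap (d : (triangleMap a c hc hc1).Dart) :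
    (triangleMap a c hc hc1).faceDegree d =
      if triangleGrading a c hc hc1 d = 0 then orderOf a else 2 * orderOf (a⁻¹ * c) := by
  have h1 : (triangleMap a c hc hc1).faceDegree d =
      minimalPeriod ((triangleRot G)⁻¹ * triangleRev a c hc) d.1 := by
    refine minimalPeriod_eq_of_injective Subtype.val_injective (fun x => ?_) d
    refine (triangleRot G).injective ?_
    have h := congrArg Subtype.val (rot_next (triangleMap a c hc hc1) x)
    exact h.trans ((triangleRot G).apply_symm_apply (triangleRev a c hc x.1)).symm
  rw [h1, triangleGrading]
  obtain ⟨⟨g, i⟩, hd⟩ := d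
  fin_cases i
  · exact minimalPeriod_triangle_next_zero a c hc g
  · exact minimalPeriod_triangle_next_one a c hc g
  · exact minimalPeriod_triangle_next_two a c hc g

theorem isSpherical_triangleMap
    (h : (1 / 2 : ℚ) < 1 / orderOf a + 2 / (2 * orderOf (a⁻¹ * c) : ℕ)) :
    (triangleMap a c hc hc1).IsSpherical := by
  apply isSpherical_of_eulerChar_pos
  have h1 := (isGrading_triangleGrading a c hc hc1).card_face_eq (faceDegree_triangleMap a c hc hc1)
  have h2 := card_vertex_eq _ (valence_triangleMap a c hc hc1)
  have h3 := (triangleMap a c hc hc1).two_mul_card_edge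
  have h4 : 0 < Nat.card (triangleMap a c hc hc1).Dart := Nat.card_pos
  rw [← h3] at h1 h2 h4
  have h5 : (0 : ℚ) < ((2 * Nat.card (triangleMap a c hc hc1).Edge : ℕ) : ℚ) / 3 := by positivity
  have h6 := mul_lt_mul_of_pos_left h h5
  rw [← h1] at h6
  have h7 : (0 : ℚ) < (Nat.card (triangleMap a c hc hc1).Vertex : ℤ)
      - (Nat.card (triangleMap a c hc hc1).Edge : ℤ) +
      (Nat.card (triangleMap a c hc hc1).Face : ℤ) := by
    push_cast at *
    linarith
  exact_mod_cast h7

end TriangleMap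

end OrientedMap

/-! ### Finite groups realising the spherical triangle orders. -/

/-- The spherical triangle groups: there are finite quotients of the triangle group `(2, k, m)`
without collapse of the orders of the generators. -/
theorem exists_spherical_triangle_generators {k m : ℕ} (hk : 3 ≤ k) (hm : 2 ≤ m)
    (h : (1 / 2 : ℚ) < 1 / k + 1 / m) :
    ∃ (G : Type) (_ : Group G) (_ : Finite G) (a c : G),
      orderOf a = k ∧ orderOf c = 2 ∧ orderOf (a⁻¹ * c) = m := by
  have hkm : k * m < 2 * m + 2 * k := by
    have hk0 : (0 : ℚ) < k := by positivity
    have hm0 : (0 : ℚ) < m := by positivity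
    rw [div_add_div _ _ hk0.ne' hm0.ne', div_lt_div_iff₀ two_pos (by positivity)] at h
    have h' : ((k * m : ℕ) : ℚ) < ((2 * m + 2 * k : ℕ) : ℚ) := by
      push_cast
      linarith
    exact_mod_cast h'
  obtain rfl | hm3 := hm.eq_or_lt
  · have : NeZero k := ⟨by omega⟩
    refine ⟨DihedralGroup k, inferInstance, inferInstance, .r 1, .sr 0, DihedralGroup.orderOf_r_one,
      DihedralGroup.orderOf_sr 0, ?_⟩
    rw [DihedralGroup.inv_r, DihedralGroup.r_mul_sr]
    exact DihedralGroup.orderOf_sr _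
  -- For m ≥ 3 only (3,3), (3,4), (3,5), (4,3) and (5,3) remain, and permutations of five points
  -- realise them all.
  · have hk6 : k < 6 := by nlinarith
    have hm6 : m < 6 := by nlinarith
    let G := Equiv.Perm (Fin 5)
    let t : G := Equiv.swap 0 1 * Equiv.swap 1 2
    let s : G := Equiv.swap 1 3 * Equiv.swap 2 4
    let s' : G := Equiv.swap 1 3 * Equiv.swap 0 2
    let s'' : G := Equiv.swap 2 3
    have key : ∀ a c : G, ∀ k m : ℕ, 0 < k → 0 < m → (c ^ 2 = 1 ∧ c ≠ 1) →
        (a ^ k = 1 ∧ ∀ i < k, 0 < i → a ^ i ≠ 1) →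
        ((a⁻¹ * c) ^ m = 1 ∧ ∀ i < m, 0 < i → (a⁻¹ * c) ^ i ≠ 1) →
        ∃ (G : Type) (_ : Group G) (_ : Finite G) (a c : G),
          orderOf a = k ∧ orderOf c = 2 ∧ orderOf (a⁻¹ * c) = m := fun a c k m hk hm hc ha hac =>
      ⟨G, inferInstance, inferInstance, a, c, (orderOf_eq_iff hk).2 ha,
        orderOf_eq_prime hc.1 hc.2, (orderOf_eq_iff hm).2 hac⟩
    interval_cases k <;> interval_cases m <;> try omega
    · exact key t s' 3 3 (by decide) (by decide) (by decide) (by decide) (by decide)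
    · exact key t s'' 3 4 (by decide) (by decide) (by decide) (by decide) (by decide)
    · exact key t s 3 5 (by decide) (by decide) (by decide) (by decide) (by decide)
    -- Taking `a = c * t` makes `a⁻¹ * c = t⁻¹`, of order 3, which interchanges the roles of k and
    -- m.
    · exact key (s'' * t) s'' 4 3 (by decide) (by decide) (by decide) (by decide) (by decide)
    · exact key (s * t) s 5 3 (by decide) (by decide) (by decide) (by decide) (by decide)

/-! ### The trivalent pattern, coverings onto it, and minimality. -/

namespace PaintedMap

open OrientedMap Equiv.Perm Function

theorem exists_trivalent_pattern {k l : ℕ} (hk : 3 ≤ k) (hl : 3 ≤ l) (hl2 : 2 ∣ l)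
    (h : (1 / 2 : ℚ) < 1 / k + 2 / l) :
    ∃ T : PaintedMap.{u}, T.IsFootballPattern k l 2 ∧ ∀ d, T.valence d = 3 := by
  obtain ⟨m, rfl⟩ := hl2
  have hm : 2 ≤ m := by omega
  have h' : (1 / 2 : ℚ) < 1 / k + 1 / m := by
    have hm0 : (m : ℚ) ≠ 0 := by positivity
    have : (2 : ℚ) / (2 * m : ℕ) = 1 / m := by
      push_cast
      field_simp
    rwa [this] at h
  obtain ⟨G, _, _, a, c, ha, hc, hac⟩ := exists_spherical_triangle_generators hk hm h'
  -- The group is lifted to the universe in which the darts live.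
  let e : G ≃* ULift.{u} G := MulEquiv.ulift.symm
  have ha' : orderOf (e a) = k := by rw [e.orderOf_eq, ha]
  have hac' : orderOf ((e a)⁻¹ * e c) = m := by rw [← map_inv, ← map_mul, e.orderOf_eq, hac]
  have hc2 : orderOf (e c) = 2 := by rw [e.orderOf_eq, hc]
  have hcc : e c * e c = 1 := by rw [← pow_two, ← hc2, pow_orderOf_eq_one]
  have hc1 : e c ≠ 1 := fun h1 => by
    rw [h1, orderOf_one] at hc2
    omega
  have hg := isGrading_triangleGrading (e a) (e c) hcc hc1
  have hf := faceDegree_triangleMap (e a) (e c) hcc hc1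
  have hs := isSpherical_triangleMap (e a) (e c) hcc hc1 (by rwa [ha', hac'])
  simp only [ha', hac'] at hf
  exact ⟨_, hg.isFootballPattern_paint hs (valence_triangleMap _ _ hcc hc1) hf,
    valence_triangleMap _ _ hcc hc1⟩

/-- Every football pattern with `n = 2` maps to the trivalent one. -/
theorem IsFootballPattern.exists_hom_trivalent {M T : PaintedMap.{u}} {k l : ℕ}
    (hM : M.IsFootballPattern k l 2) (hT : T.IsFootballPattern k l 2)
    (hv : ∀ d, T.valence d = 3) :
    ∃ f : Hom M.toOrientedMap T.toOrientedMap, ∀ d, M.side d = T.side (f.toFun d) := by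
  obtain ⟨d₀, hd₀⟩ := hM.exists_isBlack
  obtain ⟨e₀, he₀⟩ := hT.exists_isBlack
  refine hM.spherical.exists_hom (fun d e => M.side d = T.side e) (d₀ := d₀) (e₀ := e₀) ?_ ?_ ?_ ?_ ?_
  · rw [(M.side_eq_zero_iff d₀).2 hd₀, (T.side_eq_zero_iff e₀).2 he₀]
  · intro d e
    rw [hM.isGrading_side.map_rot, hT.isGrading_side.map_rot, add_left_inj]
  · intro d e
    rw [hM.isGrading_side.map_rev, hT.isGrading_side.map_rev, sub_right_inj]
  -- Trivalence of `T` is essential here: 3 is the one valence guaranteed to divide every valence of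
  -- `M`.
  · intro d e _
    rw [hv]
    exact hM.isGrading_side.three_dvd_valence d
  · intro d e hde
    rw [hM.faceDegree_eq_ite, hT.faceDegree_eq_ite, hde]

/-- A map of football patterns that preserves the labels of the darts is a branched cover. -/
theorem IsFootballPattern.nonempty_branchedCover {M N : PaintedMap.{u}} {k l : ℕ}
    (hM : M.IsFootballPattern k l 2) (hN : N.IsFootballPattern k l 2)
    (f : Hom M.toOrientedMap N.toOrientedMap) (hf : ∀ d, M.side d = N.side (f.toFun d)) :
    Nonempty (BranchedCover M N) :=
  ⟨{ toFun := f.toFun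
     surjective := f.surjective
     map_rot := f.map_rot
     map_rev := f.map_rev
     faceDegree_eq := fun d => by rw [hM.faceDegree_eq_ite, hN.faceDegree_eq_ite, hf]
     isBlack_iff := fun d => by rw [← side_eq_zero_iff, hf, side_eq_zero_iff] }⟩

theorem BranchedCover.card_face {M N : PaintedMap.{u}} (f : BranchedCover M N) (e₀ : N.Dart) :
    Nat.card M.Face = (Hom.mk f.toFun f.map_rot f.map_rev).fiberCard e₀ * Nat.card N.Face :=
  Hom.numCycles_eq_mul _ f.faceDegree_eq e₀

theorem BranchedCover.card_face_le {M N : PaintedMap.{u}} (f : BranchedCover M N) :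
    Nat.card N.Face ≤ Nat.card M.Face := by
  obtain ⟨e₀⟩ := N.nonempty_dart
  rw [f.card_face e₀]
  exact Nat.le_mul_of_pos_left _ (Hom.fiberCard_pos _ e₀)

theorem card_face_pos (M : PaintedMap.{u}) : 0 < Nat.card M.Face := by
  obtain ⟨d⟩ := M.nonempty_dart
  have : Nonempty M.Face := ⟨M.face d⟩
  have : Finite M.Face := Quotient.finite _
  exact Nat.card_pos

/-- A branched cover between patterns with the same number of faces is an isomorphism. -/
theorem BranchedCover.nonempty_iso {M N : PaintedMap.{u}} (f : BranchedCover M N)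
    (h : Nat.card M.Face ≤ Nat.card N.Face) : Nonempty (Iso M N) := by
  obtain ⟨e₀⟩ := N.nonempty_dart
  have hinj := Hom.injective_of_fiberCard_le_one (Hom.mk f.toFun f.map_rot f.map_rev) (e₀ := e₀) (by
    rw [f.card_face e₀] at h
    exact Nat.le_of_mul_le_mul_right (h.trans_eq (one_mul _).symm) N.card_face_pos)
  exact ⟨⟨Equiv.ofBijective f.toFun ⟨hinj, f.surjective⟩, f.map_rot, f.map_rev, f.isBlack_iff⟩⟩

/-- The inverse of an isomorphism. -/
def Iso.symm {M N : PaintedMap.{u}} (f : Iso M N) : Iso N M where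
  toEquiv := f.toEquiv.symm
  map_rot d := by rw [Equiv.symm_apply_eq, f.map_rot, Equiv.apply_symm_apply]
  map_rev d := by rw [Equiv.symm_apply_eq, f.map_rev, Equiv.apply_symm_apply]
  isBlack_iff d := by rw [f.isBlack_iff, Equiv.apply_symm_apply]

/-- The composition of isomorphisms. -/
def Iso.trans {M N P : PaintedMap.{u}} (f : Iso M N) (g : Iso N P) : Iso M P where
  toEquiv := f.toEquiv.trans g.toEquiv
  map_rot d := by simp [f.map_rot, g.map_rot]
  map_rev d := by simp [f.map_rev, g.map_rev]
  isBlack_iff d := (f.isBlack_iff d).trans (g.isBlack_iff _)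

theorem Iso.faceDegree_eq {M N : PaintedMap.{u}} (f : Iso M N) (d : M.Dart) :
    M.faceDegree d = N.faceDegree (f.toEquiv d) := by
  have h : Semiconj f.toEquiv M.next N.next :=
    (Hom.mk (M := M.toOrientedMap) (N := N.toOrientedMap) f.toEquiv f.map_rot f.map_rev).map_next
  exact minimalPeriod_eq_of_injective f.toEquiv.injective h d

/-- The composition of a branched cover with an isomorphism. -/
def BranchedCover.transIso {M N P : PaintedMap.{u}} (f : BranchedCover M N) (g : Iso N P) :
    BranchedCover M P where
  toFun d := g.toEquiv (f.toFun d)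
  surjective := g.toEquiv.surjective.comp f.surjective
  map_rot d := by rw [f.map_rot, g.map_rot]
  map_rev d := by rw [f.map_rev, g.map_rev]
  faceDegree_eq d := by rw [f.faceDegree_eq, g.faceDegree_eq]
  isBlack_iff d := (f.isBlack_iff d).trans (g.isBlack_iff _)

end PaintedMap

theorem theorem2p7 (k l : ℕ) (hk : 3 ≤ k) (hl : 3 ≤ l) (hl2 : 2 ∣ l)
    (hex : ∃ M : PaintedMap.{u}, M.IsFootballPattern k l 2) :
    (∃ M₀ : PaintedMap.{u}, M₀.IsMinimalRealisation k l 2) ∧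
    (∀ M₀ M : PaintedMap.{u}, M₀.IsMinimalRealisation k l 2 → M.IsFootballPattern k l 2 →
      Nonempty (PaintedMap.BranchedCover M M₀)) ∧
    (∀ M₀ M₁ : PaintedMap.{u}, M₀.IsMinimalRealisation k l 2 → M₁.IsMinimalRealisation k l 2 →
      Nonempty (PaintedMap.Iso M₀ M₁)) := by
  obtain ⟨M, hM⟩ := hex
  obtain ⟨T, hT, hv⟩ := PaintedMap.exists_trivalent_pattern.{u} hk hl hl2 hM.half_lt
  have cover : ∀ N : PaintedMap.{u}, N.IsFootballPattern k l 2 →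
      Nonempty (PaintedMap.BranchedCover N T) := fun N hN => by
    obtain ⟨f, hf⟩ := hN.exists_hom_trivalent hT hv
    exact hN.nonempty_branchedCover hT f hf
  have iso : ∀ N : PaintedMap.{u}, N.IsMinimalRealisation k l 2 →
      Nonempty (PaintedMap.Iso N T) := fun N hN => by
    obtain ⟨f⟩ := cover N hN.1
    -- Minimality bounds the faces of `N` by those of `T`, which forces degree one.
    exact f.nonempty_iso (hN.2 T hT)
  refine ⟨⟨T, hT, fun N hN => ?_⟩, fun M₀ N hM₀ hN => ?_, fun M₀ M₁ hM₀ hM₁ => ?_⟩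
  · obtain ⟨f⟩ := cover N hN
    exact f.card_face_le
  · obtain ⟨f⟩ := cover N hN
    obtain ⟨g⟩ := iso M₀ hM₀
    exact ⟨f.transIso g.symm⟩
  · obtain ⟨f⟩ := iso M₀ hM₀
    obtain ⟨g⟩ := iso M₁ hM₁
    exact ⟨f.trans g.symm⟩
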